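/- Let $f(x)=\sin x\,\Bigl(1-\dfrac{1}{8|\sin^3(x/2)|}\Bigr)$ for $x\in(0,2\pi)$. A configuration of $n$ coorbital satellites is a tuple $\theta=(\theta_1,\dots,\theta_n)$ of positive angles with $\theta_1+\dots+\theta_n=2\pi$; $\theta_i$ is the angle from the $i$-th satellite to the next one on the circle, and indices are taken cyclically modulo $n$. The configuration is a central configuration of the planar $1+n$ body problem with masses $\mu_1,\dots,\mu_n>0$ if $$\sum_{k=1}^{n-1}\mu_{i+k}\,f(\theta_i+\theta_{i+1}+\dots+\theta_{i+k-1})=0\qquad\text{for every } i=1,\dots,n.$$ **Proposition.** Let $n\ge 2$ and let all satellites have the same mass $\mu>0$. Let $\theta=(\theta_1,\dots,\theta_n)$ be a central configuration of the planar $1+n$ body problem, and let $\theta^*=(\theta^*_1,\dots,\theta^*_{n+2})$ be a configuration obtained from $\theta$ by adding two satellites separated by exactly one original satellite, that is, for some $k,l$, $$\theta_k=\theta^*_l+\theta^*_{l+1},\qquad \theta_{k+1}=\theta^*_{l+2}+\theta^*_{l+3},\qquad \theta_{k+i}=\theta^*_{l+i+2}\quad(2\le i\le n-1),$$ where the indices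 of $\theta$ are modulo $n$ and those of $\theta^*$ modulo $n+2$. Then $\theta^*$ is a central configuration of the planar $1+(n+2)$ body problem exactly in the following cases (tuples being understood up to cyclic relabelling of the satellites): - $n=2$, $\theta=(\pi,\pi)$ (collinear), and $\theta^*$ is the square $\left(\frac\pi2,\frac\pi2,\frac\pi2,\frac\pi2\right)$ or the kite $\left(\frac\pi3,\frac\pi3,\frac{2\pi}3,\frac{2\pi}3\right)$; - $n=4$, $\theta$ is the kite $\left(\frac\pi3,\frac\pi3,\frac{2\pi}3,\frac{2\pi}3\right)$, and $\theta^*$ is the regular hexagon $\left(\frac\pi3,\frac\pi3,\frac\pi3,\frac\pi3,\frac\pi3,\frac\pi3\right)$. All these cases do occur: in each of them $\theta$ and $\theta^*$ are central configurations, and $\theta^*$ is obtained from $\theta$ by adding two satellites separated by exactly one original satellite. In particular there is no such pair for any other $n\ge2$. -/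

import Mathlib

open Real

noncomputable section

namespace Coorbital

/-- The interaction function `f(x) = sin x * (1 - 1 / (8 |sin³(x/2)|))` of the planar `1 + n` body
problem; it is only evaluated at arguments in `(0, 2π)`. -/
def f (x : ℝ) : ℝ := sin x * (1 - 1 / (8 * |sin (x / 2) ^ 3|))

/-- The configuration space of `n` coorbital satellites: a configuration is the tuple of the
(positive) angles between consecutive satellites, listed counterclockwise, with sum `2π`.
Satellite `i` is followed by the angle `θ i`, at whose other end is satellite `i + 1`
(indices are cyclic). -/
def IsConfiguration {n : ℕ} (θ : Fin n → ℝ) : Prop :=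
  (∀ i, 0 < θ i) ∧ ∑ i, θ i = 2 * π

/-- The angle `θ_i + θ_{i+1} + ⋯ + θ_{i+k-1}` (cyclic indices) from satellite `i` to
satellite `i + k`. -/
def arc {n : ℕ} [NeZero n] (θ : Fin n → ℝ) (i : Fin n) (k : ℕ) : ℝ :=
  ∑ j ∈ Finset.range k, θ (i + Fin.ofNat n j)

/-- Central configurations of the planar `1 + n` body problem with infinitesimal masses
`m 0, …, m (n - 1)`: for every satellite `i`,
`m_{i+1} f(θ_i) + m_{i+2} f(θ_i + θ_{i+1}) + ⋯ + m_{i+n-1} f(θ_i + ⋯ + θ_{i+n-2}) = 0`. -/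
def IsCentralConfiguration {n : ℕ} [NeZero n] (m θ : Fin n → ℝ) : Prop :=
  IsConfiguration θ ∧
    ∀ i : Fin n, ∑ k ∈ Finset.Ico 1 n, m (i + Fin.ofNat n k) * f (arc θ i k) = 0

/-- For `n ≥ 2`: `θ'` arises from `θ` by adding two satellites that are separated by exactly one
original satellite. This original satellite is the common end of two consecutive angles `θ k`,
`θ (k + 1)` of the original configuration; each of these is divided into two by one new satellite,
and the other angles are unchanged. The labels in `θ'` may start at any satellite. -/
def AddTwoSeparatedByOne {n : ℕ} [NeZero n] (θ : Fin n → ℝ) (θ' : Fin (n + 2) → ℝ) : Prop :=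
  IsConfiguration θ ∧ IsConfiguration θ' ∧
    ∃ (k : Fin n) (l : Fin (n + 2)),
      θ k = θ' l + θ' (l + 1) ∧
      θ (k + 1) = θ' (l + 2) + θ' (l + 3) ∧
      ∀ i : ℕ, 2 ≤ i → i < n →
        θ (k + Fin.ofNat n i) = θ' (l + Fin.ofNat (n + 2) (i + 2))

/-- The tuple `θ` is the list `L` up to a cyclic relabelling (a rotation of the configuration). -/
def SameUpToRotation {n : ℕ} (θ : Fin n → ℝ) (L : List ℝ) : Prop :=
  (List.ofFn θ).IsRotated L

/-- The collinear configuration of two satellites. -/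
def collinear : List ℝ := [π, π]

/-- The square configuration of four satellites. -/
def square : List ℝ := [π / 2, π / 2, π / 2, π / 2]

/-- The kite configuration of four satellites. -/
def kite : List ℝ := [π / 3, π / 3, 2 * π / 3, 2 * π / 3]

/-- The regular hexagon configuration of six satellites. -/
def hexagon : List ℝ := [π / 3, π / 3, π / 3, π / 3, π / 3, π / 3]

end Coorbital

end

/-!
The angles are measured from the old satellite `S` between the two new ones, which are placed at
`-a` and `b`. As `f` is odd and `2 * π`-periodic, a tuple is a central configuration if and only if
the forces `f (X j - X i)` on each satellite add up to zero. Subtracting the equations of an old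
satellite before and after the addition shows that the two new satellites exert opposite forces on
it. For `S` this reads `f a = f b`, and for an old satellite at the angle `b + t` it reads
`f t = f (2 * π - a - b - t)`. The whole proof rests on pairs of angles ("twins") at which `f` takes
the same value.

Two distinct twins are written as `π - a ± δ`. With `r = cos (a / 2)`, `p = cos (δ / 2)` and
`q = sin (δ / 2)` they satisfy the polynomial equation (`twin_eq`)
`8 * p * (2 * r ^ 2 - 1) * (r ^ 2 - q ^ 2) ^ 2 = r * (2 - r ^ 2 - q ^ 2)`.
It follows that `cos a > 0` (`twin_lt_pi_div_two`), that `δ` is determined by `a` (`twin_unique`)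
and `a` by `δ` (`twin_mono`), and that `δ < 2 * π / 3` (`twin_lt_two_pi_div_three`). By the first of
these facts, the old satellites off the symmetry axis of the new ones and the pair `a ≠ b` exclude
each other, as the means of the two pairs add up to `π`. By the second one, there is at most one
mirror pair of old satellites off the axis. Hence `n ≤ 4`, and for `n ≥ 3` everything is symmetric
about the axis through `S`.

* For `n = 2` the other satellite is at `π`, because the zeros `π / 3` and `5 * π / 3` of `f` need
  `δ = 2 * π / 3`. Then `a = b`, and the remaining equation `f a + f (2 * a) = f (π - a)` has the
  solutions `π / 3`, `π / 2` and `2 * π / 3` only (`add_double_eq`).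
* For `n = 3` the old satellites are at `0` and `π ± δ` with `f (2 * δ) = f (π - δ)`. The
  equilateral triangle fails exactly; for the other solution the twin equation locates `r` in a
  short interval, on which the equation of a new satellite is violated (`no_extension_three`).
* For `n = 4` they are at `0`, `π` and `π ± δ`, where `δ` is a solution of the same equation as `a`
  for `n = 2`. Here `δ = 2 * π / 3` is not the half-difference of twins, the square (`δ = π / 2`)
  is excluded by an estimate as before, and the kite (`δ = π / 3`) forces `a = π / 3`, the hexagon
  (`extension_four`).
-/

open Real
noncomputable section
namespace Coorbital

/-! ### The interaction function -/

/-- A junk value (`1 / 0 = 0`, and `sin 0 = 0`) that allows the sums over the other satellites to be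
taken over all satellites. -/
lemma f_zero : f 0 = 0 := by simp [f]

lemma f_neg (x : ℝ) : f (-x) = -f x := by
  have h : sin (-x / 2) ^ 3 = -(sin (x / 2) ^ 3) := by
    rw [neg_div, sin_neg]; ring
  simp only [f, h, sin_neg, abs_neg]
  ring

lemma f_add_two_pi (x : ℝ) : f (x + 2 * π) = f x := by
  have h : sin ((x + 2 * π) / 2) ^ 3 = -(sin (x / 2) ^ 3) := by
    rw [show (x + 2 * π) / 2 = x / 2 + π by ring, sin_add_pi]; ring
  simp only [f, h, sin_add_two_pi, abs_neg]

lemma f_two_pi_sub (x : ℝ) : f (2 * π - x) = -f x := by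
  rw [show 2 * π - x = -x + 2 * π by ring, f_add_two_pi, f_neg]

lemma f_pi : f π = 0 := by simp [f]

/-- On the interval where `f` is evaluated it is a rational function of `sin (x / 2)` and
`cos (x / 2)`. -/
lemma f_eq_of_half {x c s : ℝ} (hc : cos (x / 2) = c) (hs : sin (x / 2) = s) (h : 0 < s) :
    f x = 2 * s * c - c / (4 * s ^ 2) := by
  have h1 : sin x = 2 * s * c := by
    rw [← hc, ← hs, ← sin_two_mul]; ring_nf
  have h2 : |s ^ 3| = s ^ 3 := abs_of_pos (by positivity)
  rw [f, h1, hs, h2]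
  field_simp
  ring

lemma f_eq_zero {x : ℝ} (h0 : 0 < x) (h2 : x < 2 * π) (h : f x = 0) :
    x = π / 3 ∨ x = π ∨ x = 5 * π / 3 := by
  have hs : 0 < sin (x / 2) := sin_pos_of_pos_of_lt_pi (by linarith) (by linarith)
  rw [f_eq_of_half rfl rfl hs] at h
  have h3 : cos (x / 2) * (8 * sin (x / 2) ^ 3 - 1) = 0 := by
    field_simp at h
    linarith
  rcases mul_eq_zero.1 h3 with h4 | h4
  · right; left
    have : x / 2 = π / 2 := by
      apply injOn_cos ⟨by linarith, by linarith⟩ ⟨by linarith, by linarith⟩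
      rw [h4, cos_pi_div_two]
    linarith
  · have h5 : sin (x / 2) = 1 / 2 := by
      have : (2 * sin (x / 2) - 1) * (4 * sin (x / 2) ^ 2 + 2 * sin (x / 2) + 1) = 0 := by
        linarith
      rcases mul_eq_zero.1 this with h6 | h6
      · linarith
      · nlinarith
    rcases le_total x π with hx | hx
    · left
      have : x / 2 = π / 6 := by
        apply injOn_sin ⟨by linarith, by linarith⟩ ⟨by linarith, by linarith⟩
        rw [h5, sin_pi_div_six]
      linarith
    · right; right
      have : π - x / 2 = π / 6 := by
        apply injOn_sin ⟨by linarith, by linarith⟩ ⟨by linarith, by linarith⟩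
        rw [sin_pi_sub, h5, sin_pi_div_six]
      linarith

lemma f_pi_div_three : f (π / 3) = 0 := by
  rw [f_eq_of_half (x := π / 3) (c := √3 / 2) (s := 1 / 2)]
  · ring
  · rw [← cos_pi_div_six]; ring_nf
  · rw [← sin_pi_div_six]; ring_nf
  · norm_num

/-- The difference and the sum of the values of `f` at two angles `π - a ± δ` with mean `π - a`,
through half-angles. The common denominator comes from
`sin ((π - a - δ) / 2) * sin ((π - a + δ) / 2) = r ^ 2 - q ^ 2`. -/
lemma f_sub_f {a δ r ρ p q : ℝ} (hr : cos (a / 2) = r) (hρ : sin (a / 2) = ρ)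
    (hp : cos (δ / 2) = p) (hq : sin (δ / 2) = q) (ha : 0 < a) (hδ : 0 < δ) (h : a + δ < π) :
    f (π - a + δ) - f (π - a - δ) =
      q * (r * (2 - r ^ 2 - q ^ 2) / (2 * (r ^ 2 - q ^ 2) ^ 2) - 4 * p * (2 * r ^ 2 - 1)) ∧
    f (π - a + δ) + f (π - a - δ) = 4 * r * ρ * (1 - 2 * q ^ 2) -
      ρ * p * (r ^ 2 + q ^ 2) / (2 * (r ^ 2 - q ^ 2) ^ 2) := by
  have e1 : r ^ 2 + ρ ^ 2 = 1 := by rw [← hr, ← hρ]; exact cos_sq_add_sin_sq _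
  have e2 : p ^ 2 + q ^ 2 = 1 := by rw [← hp, ← hq]; exact cos_sq_add_sin_sq _
  have s1 : sin ((π - a - δ) / 2) = r * p - ρ * q := by
    rw [show (π - a - δ) / 2 = π / 2 - (a / 2 + δ / 2) by ring, sin_pi_div_two_sub, cos_add,
      hr, hρ, hp, hq]
  have c1 : cos ((π - a - δ) / 2) = ρ * p + r * q := by
    rw [show (π - a - δ) / 2 = π / 2 - (a / 2 + δ / 2) by ring, cos_pi_div_two_sub, sin_add,
      hr, hρ, hp, hq]
  have s2 : sin ((π - a + δ) / 2) = r * p + ρ * q := by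
    rw [show (π - a + δ) / 2 = π / 2 - (a / 2 - δ / 2) by ring, sin_pi_div_two_sub, cos_sub,
      hr, hρ, hp, hq]
  have c2 : cos ((π - a + δ) / 2) = ρ * p - r * q := by
    rw [show (π - a + δ) / 2 = π / 2 - (a / 2 - δ / 2) by ring, cos_pi_div_two_sub, sin_sub,
      hr, hρ, hp, hq]
  have s1p : 0 < r * p - ρ * q := by
    rw [← s1]; exact sin_pos_of_pos_of_lt_pi (by linarith) (by linarith)
  have s2p : 0 < r * p + ρ * q := by
    rw [← s2]; exact sin_pos_of_pos_of_lt_pi (by linarith) (by linarith)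
  rw [f_eq_of_half c1 s1 s1p, f_eq_of_half c2 s2 s2p]
  have hprod : r ^ 2 - q ^ 2 = (r * p - ρ * q) * (r * p + ρ * q) := by
    linear_combination q ^ 2 * e1 - r ^ 2 * e2
  have i1 : (r * p + ρ * q) * (ρ * p - r * q) - (r * p - ρ * q) * (ρ * p + r * q)
      = -2 * p * q * (2 * r ^ 2 - 1) := by
    linear_combination 2 * p * q * e1
  have i2 : (ρ * p - r * q) * (r * p - ρ * q) ^ 2 - (ρ * p + r * q) * (r * p + ρ * q) ^ 2
      = -2 * r * q * (2 - r ^ 2 - q ^ 2) := by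
    linear_combination (-2 * r * q * p ^ 2 - 2 * r * q) * e1 + (-2 * r * q * ρ ^ 2 - 2 * r * q) * e2
  have i3 : (r * p + ρ * q) * (ρ * p - r * q) + (r * p - ρ * q) * (ρ * p + r * q)
      = 2 * r * ρ * (1 - 2 * q ^ 2) := by
    linear_combination 2 * r * ρ * e2
  have i4 : (ρ * p - r * q) * (r * p - ρ * q) ^ 2 + (ρ * p + r * q) * (r * p + ρ * q) ^ 2
      = 2 * ρ * p * (r ^ 2 + q ^ 2) := by
    linear_combination 2 * ρ * p * q ^ 2 * e1 + 2 * ρ * p * r ^ 2 * e2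
  have hne1 := s1p.ne'
  have hne2 := s2p.ne'
  rw [hprod]
  constructor
  · have : 2 * (r * p + ρ * q) * (ρ * p - r * q) - (ρ * p - r * q) / (4 * (r * p + ρ * q) ^ 2) -
        (2 * (r * p - ρ * q) * (ρ * p + r * q) - (ρ * p + r * q) / (4 * (r * p - ρ * q) ^ 2)) =
        2 * ((r * p + ρ * q) * (ρ * p - r * q) - (r * p - ρ * q) * (ρ * p + r * q)) -
        ((ρ * p - r * q) * (r * p - ρ * q) ^ 2 - (ρ * p + r * q) * (r * p + ρ * q) ^ 2) /
          (4 * ((r * p - ρ * q) * (r * p + ρ * q)) ^ 2) := by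
      generalize r * p + ρ * q = s2 at *
      generalize r * p - ρ * q = s1 at *
      field_simp
      ring
    rw [this, i1, i2]
    generalize (r * p - ρ * q) * (r * p + ρ * q) = w
    ring
  · have : 2 * (r * p + ρ * q) * (ρ * p - r * q) - (ρ * p - r * q) / (4 * (r * p + ρ * q) ^ 2) +
        (2 * (r * p - ρ * q) * (ρ * p + r * q) - (ρ * p + r * q) / (4 * (r * p - ρ * q) ^ 2)) =
        2 * ((r * p + ρ * q) * (ρ * p - r * q) + (r * p - ρ * q) * (ρ * p + r * q)) -
        ((ρ * p - r * q) * (r * p - ρ * q) ^ 2 + (ρ * p + r * q) * (r * p + ρ * q) ^ 2) /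
          (4 * ((r * p - ρ * q) * (r * p + ρ * q)) ^ 2) := by
      generalize r * p + ρ * q = s2 at *
      generalize r * p - ρ * q = s1 at *
      field_simp
      ring
    rw [this, i3, i4]
    generalize (r * p - ρ * q) * (r * p + ρ * q) = w
    ring

/-! ### Pairs of angles with equal values of the interaction function -/

/-- The half-angle coordinates `r = cos (a / 2)`, `ρ = sin (a / 2)`, `p = cos (δ / 2)`,
`q = sin (δ / 2)`. -/
lemma half_angle_bounds {a δ r ρ p q : ℝ} (hr : cos (a / 2) = r) (hρ : sin (a / 2) = ρ)
    (hp : cos (δ / 2) = p) (hq : sin (δ / 2) = q) (ha : 0 < a) (hδ : 0 < δ) (h : a + δ < π) :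
    0 < ρ ∧ 0 < p ∧ 0 < q ∧ q < r ∧ r < 1 ∧ r ^ 2 + ρ ^ 2 = 1 ∧ p ^ 2 + q ^ 2 = 1 := by
  have e1 : r ^ 2 + ρ ^ 2 = 1 := by rw [← hr, ← hρ]; exact cos_sq_add_sin_sq _
  have e2 : p ^ 2 + q ^ 2 = 1 := by rw [← hp, ← hq]; exact cos_sq_add_sin_sq _
  have hρ0 : 0 < ρ := hρ ▸ sin_pos_of_pos_of_lt_pi (by linarith) (by linarith)
  have hp0 : 0 < p := hp ▸ cos_pos_of_mem_Ioo ⟨by linarith, by linarith⟩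
  have hq0 : 0 < q := hq ▸ sin_pos_of_pos_of_lt_pi (by linarith) (by linarith)
  have hqr : q < r := by
    rw [← hq, ← hr, ← sin_pi_div_two_sub]
    exact sin_lt_sin_of_lt_of_le_pi_div_two (by linarith) (by linarith) (by linarith)
  exact ⟨hρ0, hp0, hq0, hqr, by nlinarith, e1, e2⟩

/-- If `f` takes equal values at two distinct angles `π - a ± δ`, then a polynomial equation holds
between the cosines and sines of `a / 2` and `δ / 2`. -/
lemma twin_eq {a δ r p q : ℝ} (hr : cos (a / 2) = r)
    (hp : cos (δ / 2) = p) (hq : sin (δ / 2) = q) (ha : 0 < a) (hδ : 0 < δ) (h : a + δ < π)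
    (hf : f (π - a - δ) = f (π - a + δ)) :
    8 * p * (2 * r ^ 2 - 1) * (r ^ 2 - q ^ 2) ^ 2 = r * (2 - r ^ 2 - q ^ 2) := by
  obtain ⟨-, hp0, hq0, hqr, hr1, -, -⟩ := half_angle_bounds hr rfl hp hq ha hδ h
  have h1 := (f_sub_f hr rfl hp hq ha hδ h).1
  rw [← hf, sub_self, eq_comm, mul_eq_zero] at h1
  have h2 := h1.resolve_left hq0.ne'
  have h3 : 0 < r ^ 2 - q ^ 2 := by nlinarith
  field_simp at h2
  linarith

/-- Equal values of `f` at two distinct angles force their mean `π - a` to exceed `π / 2`, since the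
left-hand side of `twin_eq` has the sign of `cos a`. -/
lemma twin_lt_pi_div_two {a δ : ℝ} (ha : 0 < a) (hδ : 0 < δ) (h : a + δ < π)
    (hf : f (π - a - δ) = f (π - a + δ)) : a < π / 2 := by
  obtain ⟨-, hp0, hq0, hqr, hr1, -, -⟩ := half_angle_bounds rfl rfl rfl rfl ha hδ h
  have h1 := twin_eq rfl rfl rfl ha hδ h hf
  by_contra! hc
  have h2 : cos a ≤ 0 := cos_nonpos_of_pi_div_two_le_of_le hc (by linarith)
  have h3 : cos a = 2 * cos (a / 2) ^ 2 - 1 := by rw [← cos_two_mul]; ring_nf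
  rw [h3] at h2
  have h4 : 0 < cos (a / 2) * (2 - cos (a / 2) ^ 2 - sin (δ / 2) ^ 2) :=
    mul_pos (by linarith) (by nlinarith)
  have h5 : 8 * cos (δ / 2) * (2 * cos (a / 2) ^ 2 - 1) *
      (cos (a / 2) ^ 2 - sin (δ / 2) ^ 2) ^ 2 ≤ 0 :=
    mul_nonpos_of_nonpos_of_nonneg (mul_nonpos_of_nonneg_of_nonpos (by linarith) h2) (sq_nonneg _)
  linarith

/-- For given `r` the equation of `twin_eq` has at most one solution `p`: with `z = p ^ 2` and
`k = 1 - r ^ 2` the quotient `p * (z - k) ^ 2 / (z + k)` of its two sides, up to a factor that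
depends on `r` only, is increasing for `z > k`. -/
lemma twin_not_lt {r p₁ q₁ p₂ q₂ : ℝ} (hp₁ : 0 < p₁) (hlt : p₁ < p₂)
    (hq₁ : q₁ < r) (h0 : 0 < q₁) (hr1 : r < 1)
    (e₁ : p₁ ^ 2 + q₁ ^ 2 = 1) (e₂ : p₂ ^ 2 + q₂ ^ 2 = 1)
    (h₁ : 8 * p₁ * (2 * r ^ 2 - 1) * (r ^ 2 - q₁ ^ 2) ^ 2 = r * (2 - r ^ 2 - q₁ ^ 2))
    (h₂ : 8 * p₂ * (2 * r ^ 2 - 1) * (r ^ 2 - q₂ ^ 2) ^ 2 = r * (2 - r ^ 2 - q₂ ^ 2)) :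
    False := by
  have hq : q₂ ^ 2 < q₁ ^ 2 := by nlinarith
  have hA1 : 0 < r ^ 2 - q₁ ^ 2 := by nlinarith
  have hA : r ^ 2 - q₁ ^ 2 < r ^ 2 - q₂ ^ 2 := by linarith
  have hB1 : 0 < 2 - r ^ 2 - q₁ ^ 2 := by nlinarith
  have hB2 : 0 < 2 - r ^ 2 - q₂ ^ 2 := by nlinarith
  have hr0 : 0 < r := by linarith
  have hc : 0 < 2 * r ^ 2 - 1 := by
    have : 0 < 8 * p₁ * (2 * r ^ 2 - 1) * (r ^ 2 - q₁ ^ 2) ^ 2 := by rw [h₁]; positivity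
    by_contra! hc
    have := mul_nonpos_of_nonpos_of_nonneg
      (mul_nonpos_of_nonneg_of_nonpos (by positivity : 0 ≤ 8 * p₁) hc)
      (sq_nonneg (r ^ 2 - q₁ ^ 2))
    linarith
  have hcross : (r ^ 2 - q₁ ^ 2) * (2 - r ^ 2 - q₂ ^ 2) <
      (r ^ 2 - q₂ ^ 2) * (2 - r ^ 2 - q₁ ^ 2) := by
    nlinarith [mul_pos (sub_pos.2 hq) (by nlinarith : 0 < 1 - r ^ 2)]
  have hmul : p₁ * (r ^ 2 - q₁ ^ 2) * ((r ^ 2 - q₁ ^ 2) * (2 - r ^ 2 - q₂ ^ 2)) <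
      p₂ * (r ^ 2 - q₂ ^ 2) * ((r ^ 2 - q₂ ^ 2) * (2 - r ^ 2 - q₁ ^ 2)) :=
    mul_lt_mul'' (mul_lt_mul'' hlt hA hp₁.le hA1.le) hcross (by positivity) (by positivity)
  have heq : (8 * p₁ * (2 * r ^ 2 - 1) * (r ^ 2 - q₁ ^ 2) ^ 2) * (2 - r ^ 2 - q₂ ^ 2) =
      (8 * p₂ * (2 * r ^ 2 - 1) * (r ^ 2 - q₂ ^ 2) ^ 2) * (2 - r ^ 2 - q₁ ^ 2) := by
    rw [h₁, h₂]; ring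
  have := mul_lt_mul_of_pos_left hmul (by positivity : 0 < 8 * (2 * r ^ 2 - 1))
  linarith

/-- For a given mean `π - a`, at most one pair of distinct angles has equal values of `f`. -/
lemma twin_unique {a δ₁ δ₂ : ℝ} (ha : 0 < a) (hδ₁ : 0 < δ₁) (hδ₂ : 0 < δ₂)
    (h₁ : a + δ₁ < π) (h₂ : a + δ₂ < π) (hf₁ : f (π - a - δ₁) = f (π - a + δ₁))
    (hf₂ : f (π - a - δ₂) = f (π - a + δ₂)) : δ₁ = δ₂ := by
  obtain ⟨-, hp₁, hq₁, hqr₁, hr1, -, e₁⟩ := half_angle_bounds rfl rfl rfl rfl ha hδ₁ h₁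
  obtain ⟨-, hp₂, hq₂, hqr₂, -, -, e₂⟩ := half_angle_bounds rfl rfl rfl rfl ha hδ₂ h₂
  have t₁ := twin_eq rfl rfl rfl ha hδ₁ h₁ hf₁
  have t₂ := twin_eq rfl rfl rfl ha hδ₂ h₂ hf₂
  rcases lt_trichotomy (cos (δ₁ / 2)) (cos (δ₂ / 2)) with hlt | heq | hlt
  · exact (twin_not_lt hp₁ hlt hqr₁ hq₁ hr1 e₁ e₂ t₁ t₂).elim
  · have := injOn_cos ⟨by linarith, by linarith⟩ ⟨by linarith, by linarith⟩ heq
    linarith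
  · exact (twin_not_lt hp₂ hlt hqr₂ hq₂ hr1 e₂ e₁ t₂ t₁).elim

/-- For given `p` and `q`, the left-hand side of the equation of `twin_eq` overtakes the right-hand
side only once as `r` grows. -/
lemma twin_mono {p q r₁ r₂ : ℝ} (hp : 0 < p) (hq : 0 < q) (hqr : q < r₁) (hr : r₁ < r₂)
    (hc : 0 < 2 * r₁ ^ 2 - 1)
    (h : r₁ * (2 - r₁ ^ 2 - q ^ 2) ≤ 8 * p * (2 * r₁ ^ 2 - 1) * (r₁ ^ 2 - q ^ 2) ^ 2) :
    r₂ * (2 - r₂ ^ 2 - q ^ 2) < 8 * p * (2 * r₂ ^ 2 - 1) * (r₂ ^ 2 - q ^ 2) ^ 2 := by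
  have hr1 : 0 < r₁ := by linarith
  have hr2 : 0 < r₂ := by linarith
  have hA : 0 < r₁ ^ 2 - q ^ 2 := by nlinarith
  have hlt : r₁ ^ 2 < r₂ ^ 2 := by nlinarith
  have h1 : (2 * r₁ ^ 2 - 1) * r₂ < (2 * r₂ ^ 2 - 1) * r₁ := by
    nlinarith [mul_pos (sub_pos.2 hr) (by positivity : 0 < 2 * r₁ * r₂ + 1)]
  have h2 : (r₁ ^ 2 - q ^ 2) ^ 2 < (r₂ ^ 2 - q ^ 2) ^ 2 :=
    pow_lt_pow_left₀ (by linarith) hA.le two_ne_zero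
  have h3 := mul_lt_mul'' h1 h2 (by positivity) (by positivity)
  have h4 := mul_lt_mul_of_pos_left h3 (by positivity : 0 < 8 * p)
  have h5 := mul_le_mul_of_nonneg_right h hr2.le
  have h6 : r₁ * r₂ * (2 - r₂ ^ 2 - q ^ 2) < r₁ * r₂ * (2 - r₁ ^ 2 - q ^ 2) :=
    mul_lt_mul_of_pos_left (by linarith) (by positivity)
  refine lt_of_mul_lt_mul_left ?_ hr1.le
  linarith

/-- The equation of `twin_eq` has no solution with `p ≤ 1 / 2`: there `8 * p * (r ^ 2 - q ^ 2) ≤ 1`,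
and the left-hand side is too small. -/
lemma twin_half_lt {p q r : ℝ} (hp : 0 < p) (hq : 0 < q) (hqr : q < r) (hr : r < 1)
    (e : p ^ 2 + q ^ 2 = 1)
    (h : 8 * p * (2 * r ^ 2 - 1) * (r ^ 2 - q ^ 2) ^ 2 = r * (2 - r ^ 2 - q ^ 2)) :
    1 / 2 < p := by
  by_contra! hc
  have hr0 : 0 < r := by linarith
  have hA : 0 < r ^ 2 - q ^ 2 := by nlinarith
  have hr2 : r ^ 2 < 1 := by nlinarith
  have hrhs : r ^ 2 - q ^ 2 < 2 - r ^ 2 - q ^ 2 := by linarith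
  have hAp : r ^ 2 - q ^ 2 ≤ 1 / 4 := by nlinarith
  have h8 : 8 * p * (r ^ 2 - q ^ 2) ≤ 1 := by nlinarith
  have h1 : 8 * p * (2 * r ^ 2 - 1) * (r ^ 2 - q ^ 2) ^ 2 ≤ r * (r ^ 2 - q ^ 2) := by
    have hs : 2 * r ^ 2 - 1 ≤ r := by nlinarith
    calc _ = (8 * p * (r ^ 2 - q ^ 2)) * (r ^ 2 - q ^ 2) * (2 * r ^ 2 - 1) := by ring
      _ ≤ (8 * p * (r ^ 2 - q ^ 2)) * (r ^ 2 - q ^ 2) * r :=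
        mul_le_mul_of_nonneg_left hs (by positivity)
      _ ≤ 1 * (r ^ 2 - q ^ 2) * r := by gcongr
      _ = _ := by ring
  nlinarith [mul_lt_mul_of_pos_left hrhs hr0]

lemma twin_lt_two_pi_div_three {a δ : ℝ} (ha : 0 < a) (hδ : 0 < δ) (h : a + δ < π)
    (hf : f (π - a - δ) = f (π - a + δ)) : δ < 2 * π / 3 := by
  obtain ⟨-, hp, hq, hqr, hr, -, e⟩ := half_angle_bounds rfl rfl rfl rfl ha hδ h
  have h1 := twin_half_lt hp hq hqr hr e (twin_eq rfl rfl rfl ha hδ h hf)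
  by_contra! hc
  have : cos (δ / 2) ≤ cos (π / 3) := cos_le_cos_of_nonneg_of_le_pi (by positivity)
    (by linarith) (by linarith)
  rw [cos_pi_div_three] at this
  linarith

/-! ### Equations in one angle -/

lemma f_two_mul {a r ρ : ℝ} (hr : cos (a / 2) = r) (hρ : sin (a / 2) = ρ) (ha : 0 < a)
    (h : a < π) :
    f (2 * a) = 4 * r * ρ * (2 * r ^ 2 - 1) - (2 * r ^ 2 - 1) / (16 * r ^ 2 * ρ ^ 2) := by
  have hρ0 : 0 < ρ := hρ ▸ sin_pos_of_pos_of_lt_pi (by linarith) (by linarith)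
  have hr0 : 0 < r := hr ▸ cos_pos_of_mem_Ioo ⟨by linarith, by linarith⟩
  have hs : sin (2 * a / 2) = 2 * ρ * r := by rw [← hρ, ← hr, ← sin_two_mul]; ring_nf
  have hc : cos (2 * a / 2) = 2 * r ^ 2 - 1 := by rw [← hr, ← cos_two_mul]; ring_nf
  rw [f_eq_of_half hc hs (by positivity)]
  ring

lemma f_pi_sub {a r ρ : ℝ} (hr : cos (a / 2) = r) (hρ : sin (a / 2) = ρ) (ha : 0 < a)
    (h : a < π) : f (π - a) = 2 * r * ρ - ρ / (4 * r ^ 2) := by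
  have hr0 : 0 < r := hr ▸ cos_pos_of_mem_Ioo ⟨by linarith, by linarith⟩
  have hs : sin ((π - a) / 2) = r := by rw [← hr, ← sin_pi_div_two_sub]; ring_nf
  have hc : cos ((π - a) / 2) = ρ := by rw [← hρ, ← cos_pi_div_two_sub]; ring_nf
  exact f_eq_of_half hc hs hr0

/-- The function `(64 m ^ 3 - 1) * √(1 + 2 m) - 4 * (1 + m)` vanishes only at `m = √3 / 4`. -/
lemma sq_eq_of_cubic {m w : ℝ} (hm0 : 0 < m) (hw0 : 0 < w) (hwm : w ^ 2 = 1 + 2 * m)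
    (h0 : (64 * m ^ 3 - 1) * w = 4 * (1 + m)) : m = √3 / 4 := by
  have h3 : √3 ^ 2 = 3 := sq_sqrt (by norm_num)
  have h30 : 0 < √3 := by positivity
  obtain ⟨m₀, hm₀⟩ : ∃ m₀, √3 / 4 = m₀ := ⟨_, rfl⟩
  obtain ⟨w₀, hw₀⟩ : ∃ w₀, (1 + √3) / 2 = w₀ := ⟨_, rfl⟩
  have hm2 : m₀ ^ 2 = 3 / 16 := by rw [← hm₀, div_pow, h3]; norm_num
  have hm₀0 : 0 < m₀ := hm₀ ▸ by positivity
  have hw₀1 : 1 < w₀ := by nlinarith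
  have hwm₀ : w₀ ^ 2 = 1 + 2 * m₀ := by rw [← hm₀, ← hw₀]; linear_combination h3 / 4
  have h00 : (64 * m₀ ^ 3 - 1) * w₀ = 4 * (1 + m₀) := by
    rw [← hm₀, ← hw₀]; linear_combination (√3 + √3 ^ 2) / 2 * h3 + h3 * (3 / 2)
  have h64 : 0 < 64 * m ^ 3 - 1 := by
    by_contra! hc
    linarith [mul_nonpos_of_nonpos_of_nonneg hc hw0.le]
  have h5 : 12 ≤ 64 * (m₀ ^ 2 + m₀ * m + m ^ 2) := by
    linarith [mul_pos hm₀0 hm0, sq_nonneg m]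
  have h6 : 12 * 1 ≤ 64 * (m₀ ^ 2 + m₀ * m + m ^ 2) * w₀ :=
    mul_le_mul h5 hw₀1.le (by norm_num) (by linarith)
  rw [hm₀]
  rcases lt_trichotomy m m₀ with hlt | heq | hlt
  · have hww : w < w₀ := lt_of_pow_lt_pow_left₀ 2 (by linarith) (by linarith)
    have h1 := mul_lt_mul_of_pos_left hww h64
    linarith [mul_le_mul_of_nonneg_left h6 (sub_pos.2 hlt).le]
  · exact heq
  · have hww : w₀ < w := lt_of_pow_lt_pow_left₀ 2 (by linarith) (by linarith)
    have h1 := mul_lt_mul_of_pos_left hww h64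
    linarith [mul_le_mul_of_nonneg_left h6 (sub_pos.2 hlt).le]

/-- In half-angles the equation is `(r - ρ) * ((64 m ^ 3 - 1) * w - 4 * (1 + m)) = 0` with `m = r ρ`
and `w = r + ρ`. -/
lemma add_double_eq {a : ℝ} (ha : 0 < a) (h : a < π) (he : f a + f (2 * a) = f (π - a)) :
    a = π / 3 ∨ a = π / 2 ∨ a = 2 * π / 3 := by
  obtain ⟨r, hr⟩ : ∃ r, cos (a / 2) = r := ⟨_, rfl⟩
  obtain ⟨ρ, hρ⟩ : ∃ ρ, sin (a / 2) = ρ := ⟨_, rfl⟩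
  have e1 : r ^ 2 + ρ ^ 2 = 1 := by rw [← hr, ← hρ]; exact cos_sq_add_sin_sq _
  have hρ0 : 0 < ρ := hρ ▸ sin_pos_of_pos_of_lt_pi (by linarith) (by linarith)
  have hr0 : 0 < r := hr ▸ cos_pos_of_mem_Ioo ⟨by linarith, by linarith⟩
  rw [f_eq_of_half hr hρ hρ0, f_two_mul hr hρ ha h, f_pi_sub hr hρ ha h,
    show 2 * r ^ 2 - 1 = r ^ 2 - ρ ^ 2 by linarith] at he
  have hfac : (r - ρ) * ((64 * (r * ρ) ^ 3 - 1) * (r + ρ) - 4 * (1 + r * ρ)) = 0 := by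
    have h1 : -4 * r ^ 3 + 64 * r ^ 3 * ρ ^ 3 * (r ^ 2 - ρ ^ 2) - (r ^ 2 - ρ ^ 2) + 4 * ρ ^ 3
        = 0 := by
      field_simp at he
      linarith
    linear_combination h1 + 4 * (r - ρ) * e1
  rcases mul_eq_zero.1 hfac with h0 | h0
  · right; left
    have : a / 2 = π / 2 - a / 2 := by
      apply injOn_sin ⟨by linarith, by linarith⟩ ⟨by linarith, by linarith⟩
      rw [sin_pi_div_two_sub, hr, hρ]
      linarith
    linarith
  · have hmm := sq_eq_of_cubic (m := r * ρ) (w := r + ρ) (by positivity) (by positivity)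
      (by linear_combination e1) (by linarith)
    have hsin : sin a = sin (π / 3) := by
      have hs : sin a = 2 * ρ * r := by rw [← hρ, ← hr, ← sin_two_mul]; ring_nf
      rw [hs, sin_pi_div_three]; linarith
    rcases le_total a (π / 2) with h2 | h2
    · left
      exact injOn_sin ⟨by linarith, by linarith⟩ ⟨by linarith, by linarith⟩ hsin
    · right; right
      have : π - a = π / 3 := by
        apply injOn_sin ⟨by linarith, by linarith⟩ ⟨by linarith, by linarith⟩
        rw [sin_pi_sub, hsin]
      linarith

/-- The isosceles central configurations of three satellites, with the angles `π - δ`, `2 * δ`,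
`π - δ`. Besides the equilateral one (`q = 1 / 2`) and one with `p ≤ 1 / 2` there is
one with `q ≈ 0.352`. -/
lemma double_eq {δ p q : ℝ} (hp : cos (δ / 2) = p) (hq : sin (δ / 2) = q)
    (hδ : 0 < δ) (h : δ < π) (hp2 : 1 / 2 < p) (hf : f (2 * δ) = f (π - δ)) :
    q = 1 / 2 ∨ 0.35 < q ∧ q < 0.36 := by
  have e : p ^ 2 + q ^ 2 = 1 := by rw [← hp, ← hq]; exact cos_sq_add_sin_sq _
  have hq0 : 0 < q := hq ▸ sin_pos_of_pos_of_lt_pi (by linarith) (by linarith)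
  have hp0 : 0 < p := by linarith
  rw [f_two_mul hp hq hδ h, f_pi_sub hp hq hδ h,
    show 2 * p ^ 2 - 1 = 1 - 2 * q ^ 2 by linarith] at hf
  have hfac : (2 * q - 1) * (32 * (p * q) ^ 3 * (2 * q + 1) - (1 + 2 * q + 2 * q ^ 2)) = 0 := by
    field_simp at hf
    linear_combination -hf / 4
  rcases mul_eq_zero.1 hfac with h0 | h0
  · left; linarith
  right
  have hm : (p * q) ^ 2 = q ^ 2 * (1 - q ^ 2) := by linear_combination q ^ 2 * e
  obtain ⟨m, hm'⟩ : ∃ m, p * q = m := ⟨_, rfl⟩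
  rw [hm'] at h0 hm
  have hm0 : 0 < m := hm' ▸ by positivity
  have hq2 : q ^ 2 < 0.75 := by nlinarith
  -- It remains to bound `32 * m ^ 3` against `(1 + 2 * q + 2 * q ^ 2) / (2 * q + 1)`, where
  -- `m ^ 2 = q ^ 2 * (1 - q ^ 2)`; the cuts at `0.33` and `0.42` make constant bounds on `m` suffice.
  constructor
  · by_contra! hc
    rcases le_total q 0.33 with hc' | hc'
    · have hx : q ^ 2 ≤ 0.33 ^ 2 := by gcongr
      have hm1 : m ≤ 0.312 := abs_le_of_sq_le_sq' (by nlinarith) (by norm_num) |>.2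
      have hm3 : m ^ 3 ≤ 0.312 ^ 3 := by gcongr
      nlinarith
    · have hx : q ^ 2 ≤ 0.35 ^ 2 := by gcongr
      have hm1 : m ≤ 0.32787 := abs_le_of_sq_le_sq' (by nlinarith) (by norm_num) |>.2
      have hm3 : m ^ 3 ≤ 0.32787 ^ 3 := by gcongr
      nlinarith
  · by_contra! hc
    have hm3 (c : ℝ) (hc0 : 0 ≤ c) (hcm : c ^ 2 ≤ m ^ 2) : c ^ 3 ≤ m ^ 3 :=
      pow_le_pow_left₀ hc0 (abs_le_of_sq_le_sq' hcm hm0.le |>.2) 3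
    rcases le_total q 0.42 with hc' | hc'
    · have hx : (0.36 : ℝ) ^ 2 ≤ q ^ 2 := by gcongr
      have := hm3 0.3358 (by norm_num) (by nlinarith)
      nlinarith
    · have hx : (0.42 : ℝ) ^ 2 ≤ q ^ 2 := by gcongr
      have := hm3 0.381 (by norm_num) (by nlinarith)
      nlinarith

/-! ### Numerical exclusion of the remaining symmetric configurations -/

/-- The kite, given by `δ = π / 3`, has old satellites in balance only with new ones at the angles
`± π / 3`. -/
lemma eq_pi_div_three_of_twin {a : ℝ} (ha : 0 < a) (h : a + π / 3 < π)
    (hf : f (π - a - π / 3) = f (π - a + π / 3)) : a = π / 3 := by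
  have hδ : 0 < π / 3 := by positivity
  obtain ⟨r, hr⟩ : ∃ r, cos (a / 2) = r := ⟨_, rfl⟩
  have hp : cos (π / 3 / 2) = √3 / 2 := by
    rw [show π / 3 / 2 = π / 6 by ring, cos_pi_div_six]
  have hq : sin (π / 3 / 2) = 1 / 2 := by
    rw [show π / 3 / 2 = π / 6 by ring, sin_pi_div_six]
  obtain ⟨-, hp0, hq0, hqr, hr1, -, -⟩ := half_angle_bounds hr rfl hp hq ha hδ h
  have ht := twin_eq hr hp hq ha hδ h hf
  have hlt := twin_lt_pi_div_two ha hδ h hf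
  have hcos : 0 < 2 * r ^ 2 - 1 := by
    rw [← hr, ← cos_two_mul]
    exact cos_pos_of_mem_Ioo ⟨by linarith, by linarith⟩
  have h3 : √3 ^ 2 = 3 := sq_sqrt (by norm_num)
  have h0 : 8 * (√3 / 2) * (2 * (√3 / 2) ^ 2 - 1) * ((√3 / 2) ^ 2 - (1 / 2) ^ 2) ^ 2 =
      √3 / 2 * (2 - (√3 / 2) ^ 2 - (1 / 2) ^ 2) := by
    rw [div_pow, h3]; ring
  have hr3 : r = √3 / 2 := by
    rcases lt_trichotomy r (√3 / 2) with hlt | heq | hlt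
    · have := twin_mono hp0 hq0 hqr hlt hcos ht.ge
      linarith
    · exact heq
    · have := twin_mono hp0 hq0 (by nlinarith) hlt (by nlinarith) h0.ge
      linarith
  have : a / 2 = π / 6 := by
    apply injOn_cos ⟨by linarith, by linarith⟩ ⟨by linarith, by linarith⟩
    rw [hr, hr3, cos_pi_div_six]
  linarith

/-- The residual of the equation of a new satellite is positive near the only candidate for an
extension of an isosceles triangle, `q ≈ 0.3521` and `r ≈ 0.8360`; here `x` stands for `q ^ 2`. -/
lemma residual_isosceles_pos {p r ρ x : ℝ} (hr1 : 0.833 < r) (hr2 : r < 0.839) (hx1 : 0.1225 < x)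
    (hx2 : x < 0.1296) (hp : 0.9329 < p) (hρ0 : 0 < ρ) (e : r ^ 2 + ρ ^ 2 = 1) :
    4 * r * ρ * (1 - 2 * x) - ρ * p * (r ^ 2 + x) / (2 * (r ^ 2 - x) ^ 2) <
      2 * ρ * r - r / (4 * ρ ^ 2) +
        (4 * r * ρ * (2 * r ^ 2 - 1) - (2 * r ^ 2 - 1) / (16 * r ^ 2 * ρ ^ 2)) := by
  have hy1 : 0.833 ^ 2 < r ^ 2 := by gcongr
  have hy2 : r ^ 2 < 0.839 ^ 2 := by gcongr
  have hρ1 : 0.5441 < ρ := lt_of_pow_lt_pow_left₀ 2 hρ0.le (by linarith)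
  have hρy : ρ ^ 2 = 1 - r ^ 2 := by linarith
  rw [hρy]
  generalize r ^ 2 = y at *
  have hy3 : 0 < 1 - y := by linarith
  have hy4 : 0 < y := by linarith
  have hy5 : 0 < y - x := by linarith
  have t1 : r / (4 * (1 - y)) ≤ 0.7085 := by
    rw [div_le_iff₀ (by positivity)]; linarith
  have t2 : (2 * y - 1) / (16 * y * (1 - y)) ≤ 0.123 := by
    rw [div_le_iff₀ (by positivity)]
    linarith [mul_pos (sub_pos.2 hy1) (sub_pos.2 hy2)]
  have hρp : 0.5441 * 0.9329 ≤ ρ * p := by gcongr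
  have t3 : 0.612 ≤ ρ * p * (y + x) / (2 * (y - x) ^ 2) := by
    rw [le_div_iff₀ (by positivity)]
    have h1 : 0.5441 * 0.9329 * 0.816389 ≤ ρ * p * (y + x) := by gcongr; linarith
    have h2 : (y - x) ^ 2 ≤ 0.581421 ^ 2 := by gcongr; linarith
    linarith
  have t4 : 0.833 * 0.5441 * 0.2655 ≤ r * ρ * (4 * y + 4 * x - 3) := by
    gcongr; linarith
  linarith

/-- The central configurations of three satellites at the angles `0` and `π ± δ` do not extend by
new satellites at the angles `± a`. -/
lemma no_extension_three {a δ : ℝ} (ha : 0 < a) (hδ : 0 < δ) (h : a + δ < π)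
    (hf : f (π - a - δ) = f (π - a + δ)) (h2 : f (2 * δ) = f (π - δ))
    (hP : f a + f (2 * a) = f (π - a - δ) + f (π - a + δ)) : False := by
  obtain ⟨r, hr⟩ : ∃ r, cos (a / 2) = r := ⟨_, rfl⟩
  obtain ⟨ρ, hρ⟩ : ∃ ρ, sin (a / 2) = ρ := ⟨_, rfl⟩
  obtain ⟨p, hp⟩ : ∃ p, cos (δ / 2) = p := ⟨_, rfl⟩
  obtain ⟨q, hq⟩ : ∃ q, sin (δ / 2) = q := ⟨_, rfl⟩
  obtain ⟨hρ0, hp0, hq0, hqr, hr1, e1, e2⟩ := half_angle_bounds hr hρ hp hq ha hδ h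
  have ht := twin_eq hr hp hq ha hδ h hf
  have hp2 := twin_half_lt hp0 hq0 hqr hr1 e2 ht
  have hlt := twin_lt_pi_div_two ha hδ h hf
  rcases double_eq hp hq hδ (by linarith) hp2 h2 with hq1 | ⟨hq1, hq2⟩
  -- The equilateral triangle: `a = π / 3`, and then the equation `hP` reads `f (2 * π / 3) = 0`.
  · have hδ3 : δ / 2 = π / 6 := by
      apply injOn_sin ⟨by linarith, by linarith⟩ ⟨by linarith, by linarith⟩
      rw [hq, hq1, sin_pi_div_six]
    obtain rfl : δ = π / 3 := by linarith
    obtain rfl := eq_pi_div_three_of_twin ha h hf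
    rw [← hf, show π - π / 3 - π / 3 = π / 3 by ring, f_pi_div_three] at hP
    rcases f_eq_zero (by positivity) (by linarith) (by linarith : f (2 * (π / 3)) = 0) with
      h0 | h0 | h0 <;> linarith
  have hr0 : 0 < r := hq0.trans hqr
  have hcos : 0 < 2 * r ^ 2 - 1 := by
    rw [← hr, ← cos_two_mul]
    exact cos_pos_of_mem_Ioo ⟨by linarith, by linarith⟩
  obtain ⟨x, hx⟩ : ∃ x, q ^ 2 = x := ⟨_, rfl⟩
  have hx1 : 0.1225 < x := by rw [← hx]; nlinarith
  have hx2 : x < 0.1296 := by rw [← hx]; nlinarith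
  have hp3 : 0.9329 < p := lt_of_pow_lt_pow_left₀ 2 hp0.le (by linarith)
  have hp4 : p < 0.9368 := lt_of_pow_lt_pow_left₀ 2 (by norm_num) (by linarith)
  -- `ht` confines `r` to a short interval, since its two sides cross only once.
  have hr3 : r < 0.839 := by
    by_contra! hc
    have h1 : 8 * 0.9329 * (2 * 0.8389 ^ 2 - 1) * (0.8389 ^ 2 - 0.1296) ^ 2 ≤
        8 * p * (2 * 0.8389 ^ 2 - 1) * (0.8389 ^ 2 - x) ^ 2 := by gcongr
    have := twin_mono (r₁ := 0.8389) (r₂ := r) hp0 hq0 (by linarith) (by linarith) (by norm_num)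
      (by rw [hx]; linarith)
    linarith
  have hr2 : 0.833 < r := by
    by_contra! hc
    have := twin_mono (r₂ := 0.8331) hp0 hq0 hqr (by linarith) hcos ht.ge
    rw [hx] at this
    have h1 : 8 * p * (2 * 0.8331 ^ 2 - 1) * (0.8331 ^ 2 - x) ^ 2 ≤
        8 * 0.9368 * (2 * 0.8331 ^ 2 - 1) * (0.8331 ^ 2 - 0.1225) ^ 2 := by
      gcongr
      linarith
    linarith
  rw [f_eq_of_half hr hρ hρ0, f_two_mul hr hρ ha (by linarith), add_comm (f (π - a - δ)),
    (f_sub_f hr hρ hp hq ha hδ h).2, hx] at hP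
  have := residual_isosceles_pos hr2 hr3 hx1 hx2 hp3 hρ0 e1
  rw [← hx] at hP this
  linarith

/-- The residual of the equation of a new satellite is positive near the only candidate for an
extension of the square, `p ^ 2 = 1 / 2` and `r ≈ 0.9342`. -/
lemma residual_square_pos {p r ρ : ℝ} (hr1 : 0.933 < r) (hr2 : r < 0.9345)
    (hp : 0.7071 < p) (hρ0 : 0 < ρ) (e : r ^ 2 + ρ ^ 2 = 1) :
    4 * r * ρ * (1 - 2 * (1 / 2)) - ρ * p * (r ^ 2 + 1 / 2) / (2 * (r ^ 2 - 1 / 2) ^ 2) <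
      2 * ρ * r - r / (4 * ρ ^ 2) +
        (4 * r * ρ * (2 * r ^ 2 - 1) - (2 * r ^ 2 - 1) / (16 * r ^ 2 * ρ ^ 2)) -
        (2 * r * ρ - ρ / (4 * r ^ 2)) := by
  have hy1 : 0.933 ^ 2 < r ^ 2 := by gcongr
  have hy2 : r ^ 2 < 0.9345 ^ 2 := by gcongr
  have hρ1 : 0.35595 < ρ := lt_of_pow_lt_pow_left₀ 2 hρ0.le (by linarith)
  have hρy : ρ ^ 2 = 1 - r ^ 2 := by linarith
  rw [hρy]
  generalize r ^ 2 = y at *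
  have hy3 : 0 < 1 - y := by linarith
  have hy4 : 0 < y := by linarith
  have hy5 : 0 < y - 1 / 2 := by linarith
  have t1 : r / (4 * (1 - y)) ≤ 1.844 := by
    rw [div_le_iff₀ (by positivity)]; linarith
  have t2 : (2 * y - 1) / (16 * y * (1 - y)) ≤ 0.43 := by
    rw [div_le_iff₀ (by positivity)]
    linarith [mul_pos (sub_pos.2 hy1) (sub_pos.2 hy2)]
  have hρp : 0.35595 * 0.7071 ≤ ρ * p := by gcongr
  have t3 : 1.237 ≤ ρ * p * (y + 1 / 2) / (2 * (y - 1 / 2) ^ 2) := by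
    rw [le_div_iff₀ (by positivity)]
    have h1 : 0.35595 * 0.7071 * 1.370489 ≤ ρ * p * (y + 1 / 2) := by gcongr; linarith
    have h2 : (y - 1 / 2) ^ 2 ≤ 0.37329025 ^ 2 := by gcongr; linarith
    linarith
  have t4 : 0.933 * 0.35595 * 0.740978 ≤ r * ρ * (2 * y - 1) := by
    gcongr; linarith
  have t5 : 0.1 ≤ ρ / (4 * y) := by
    rw [le_div_iff₀ (by positivity)]; linarith
  linarith

/-- The square does not extend by two satellites at the angles `± a`. -/
lemma no_extension_square {a : ℝ} (ha : 0 < a) (h : a + π / 2 < π)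
    (hf : f (π - a - π / 2) = f (π - a + π / 2))
    (hP : f a + f (2 * a) - f (π - a) = f (π - a - π / 2) + f (π - a + π / 2)) : False := by
  have hδ : 0 < π / 2 := by positivity
  obtain ⟨r, hr⟩ : ∃ r, cos (a / 2) = r := ⟨_, rfl⟩
  obtain ⟨ρ, hρ⟩ : ∃ ρ, sin (a / 2) = ρ := ⟨_, rfl⟩
  obtain ⟨p, hp⟩ : ∃ p, cos (π / 2 / 2) = p := ⟨_, rfl⟩
  have hq : sin (π / 2 / 2) = p := by
    rw [← hp, show π / 2 / 2 = π / 4 by ring, sin_pi_div_four, cos_pi_div_four]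
  obtain ⟨hρ0, hp0, -, hqr, hr1, e1, e2⟩ := half_angle_bounds hr hρ hp hq ha hδ h
  have ht := twin_eq hr hp hq ha hδ h hf
  have hx : p ^ 2 = 1 / 2 := by linarith
  have hp3 : 0.7071 < p := lt_of_pow_lt_pow_left₀ 2 hp0.le (by linarith)
  have hp4 : p < 0.70711 := lt_of_pow_lt_pow_left₀ 2 (by norm_num) (by linarith)
  have hr0 : 0 < r := hp0.trans hqr
  have hcos : 0 < 2 * r ^ 2 - 1 := by nlinarith
  -- `ht` confines `r` to a short interval, since its two sides cross only once.
  have hr3 : r < 0.9345 := by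
    by_contra! hc
    have h1 : 8 * 0.7071 * (2 * 0.93449 ^ 2 - 1) * (0.93449 ^ 2 - 1 / 2) ^ 2 ≤
        8 * p * (2 * 0.93449 ^ 2 - 1) * (0.93449 ^ 2 - 1 / 2) ^ 2 := by gcongr
    have := twin_mono (r₁ := 0.93449) (r₂ := r) hp0 hp0 (by linarith) (by linarith) (by norm_num)
      (by rw [hx]; linarith)
    linarith
  have hr2 : 0.933 < r := by
    by_contra! hc
    have := twin_mono (r₂ := 0.9331) hp0 hp0 hqr (by linarith) hcos ht.ge
    rw [hx] at this
    have h1 : 8 * p * (2 * 0.9331 ^ 2 - 1) * (0.9331 ^ 2 - 1 / 2) ^ 2 ≤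
        8 * 0.70711 * (2 * 0.9331 ^ 2 - 1) * (0.9331 ^ 2 - 1 / 2) ^ 2 := by
      gcongr
    linarith
  rw [f_eq_of_half hr hρ hρ0, f_two_mul hr hρ ha (by linarith), f_pi_sub hr hρ ha (by linarith),
    add_comm (f (π - a - π / 2)), (f_sub_f hr hρ hp hq ha hδ h).2, hx] at hP
  have := residual_square_pos hr2 hr3 hp3 hρ0 e1
  linarith

/-- The central configurations of four satellites at the angles `0`, `π` and `π ± δ` extend by new
satellites at the angles `± a` only from the kite to the hexagon. -/
lemma extension_four {a δ : ℝ} (ha : 0 < a) (hδ : 0 < δ) (h : a + δ < π)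
    (hf : f (π - a - δ) = f (π - a + δ)) (h2 : f δ + f (2 * δ) = f (π - δ))
    (hP : f a + f (2 * a) - f (π - a) = f (π - a - δ) + f (π - a + δ)) :
    a = π / 3 ∧ δ = π / 3 := by
  rcases add_double_eq hδ (by linarith) h2 with rfl | rfl | rfl
  · exact ⟨eq_pi_div_three_of_twin ha h hf, rfl⟩
  · exact (no_extension_square ha h hf hP).elim
  · exact absurd (twin_lt_two_pi_div_three ha hδ h hf) (lt_irrefl _)

/-! ### Classification in terms of positions -/

lemma twin_of_eq {c t : ℝ} (ht : 0 < t) (ht2 : t < 2 * π - 2 * c)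
    (h : f t = f (2 * π - 2 * c - t)) (hne : t ≠ π - c) :
    0 < |t - (π - c)| ∧ c + |t - (π - c)| < π ∧
      f (π - c - |t - (π - c)|) = f (π - c + |t - (π - c)|) := by
  refine ⟨abs_pos.2 (sub_ne_zero.2 hne), ?_, ?_⟩
  · have : |t - (π - c)| < π - c := abs_lt.2 ⟨by linarith, by linarith⟩
    linarith
  · rcases abs_choice (t - (π - c)) with h1 | h1 <;> rw [h1]
    · rw [show π - c - (t - (π - c)) = 2 * π - 2 * c - t by ring,
        show π - c + (t - (π - c)) = t by ring, h]
    · rw [show π - c - -(t - (π - c)) = t by ring,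
        show π - c + -(t - (π - c)) = 2 * π - 2 * c - t by ring, h]

/-- The equations for a central configuration of satellites at the angles
`X 0 = 0 < X 1 < ⋯ < X (n - 1) < 2 * π` that stays central when satellites are added at the angles
`-a` and `b`, so that they are separated exactly by the satellite at `0`. The values `X j` with
`n ≤ j` continue the positions around the circle; only their monotonicity is recorded. The field
`balance` says that the two new satellites exert opposite forces on each old one, and `new` is the
equation of the new satellite at `-a`. -/
structure Extension (n : ℕ) (X : ℕ → ℝ) (a b : ℝ) : Prop where
  two_le : 2 ≤ n
  a_pos : 0 < a
  b_pos : 0 < b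
  zero : X 0 = 0
  lt_succ : ∀ j, X j < X (j + 1)
  gt : ∀ j, 1 ≤ j → j < n → b < X j
  lt : ∀ j, 1 ≤ j → j < n → X j < 2 * π - a
  central : ∀ m, m < n → ∑ j ∈ Finset.range n, f (X j - X m) = 0
  balance : ∀ j, j < n → f (b - X j) = f (a + X j)
  new : ∑ j ∈ Finset.range n, f (X j + a) + f (a + b) = 0

namespace Extension
variable {n : ℕ} {X : ℕ → ℝ} {a b : ℝ}

/-- The axis of symmetry of the two new satellites meets the circle again at the angle
`π - (a - b) / 2`. An old satellite off this axis gives two distinct angles with equal values of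
`f`, with mean `π - (a + b) / 2`. -/
lemma twin (h : Extension n X a b) {j : ℕ} (h1 : 1 ≤ j) (hn : j < n)
    (hne : X j ≠ π - (a - b) / 2) :
    0 < |X j - (π - (a - b) / 2)| ∧ (a + b) / 2 + |X j - (π - (a - b) / 2)| < π ∧
      f (π - (a + b) / 2 - |X j - (π - (a - b) / 2)|) =
        f (π - (a + b) / 2 + |X j - (π - (a - b) / 2)|) := by
  have ha := h.a_pos
  have hb := h.b_pos
  have hgt := h.gt j h1 hn
  have hlt := h.lt j h1 hn
  have hbal := h.balance j hn
  rw [show b - X j = -(X j - b) by ring, f_neg,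
    show a + X j = 2 * π - (2 * π - 2 * ((a + b) / 2) - (X j - b)) by ring, f_two_pi_sub] at hbal
  have := twin_of_eq (c := (a + b) / 2) (t := X j - b) (by linarith) (by linarith)
    (by linarith) (fun he => hne (by linarith))
  rwa [show X j - b - (π - (a + b) / 2) = X j - (π - (a - b) / 2) by ring] at this

lemma f_eq (h : Extension n X a b) : f a = f b := by
  have := h.balance 0 (by linarith [h.two_le])
  rw [h.zero, sub_zero, add_zero] at this
  exact this.symm

lemma add_lt (h : Extension n X a b) : a + b < 2 * π := by
  have h1 := h.gt 1 le_rfl (by linarith [h.two_le])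
  have h2 := h.lt 1 le_rfl (by linarith [h.two_le])
  linarith

/-- If the two new satellites are at different distances from the old one between them, these
distances are two distinct angles with equal values of `f`, with mean `(a + b) / 2`. -/
lemma twin_ab (h : Extension n X a b) (hne : a ≠ b) :
    π / 2 < (a + b) / 2 ∧ |(a - b) / 2| < 2 * π / 3 := by
  have hlt := h.add_lt
  obtain ⟨h1, h2, h3⟩ := twin_of_eq (c := π - (a + b) / 2) (t := a) h.a_pos
    (by linarith [h.b_pos]) (by rw [h.f_eq]; congr 1; ring) (fun he => hne (by linarith))
  rw [show a - (π - (π - (a + b) / 2)) = (a - b) / 2 by ring] at h1 h2 h3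
  have h4 := twin_lt_pi_div_two (by linarith) h1 h2 h3
  have h5 := twin_lt_two_pi_div_three (by linarith) h1 h2 h3
  exact ⟨by linarith, h5⟩

/-- The two new satellites are symmetric about the old one between them as soon as some other old
satellite is not on the axis of symmetry. -/
lemma eq_of_ne (h : Extension n X a b) {j : ℕ} (h1 : 1 ≤ j) (hn : j < n)
    (hne : X j ≠ π - (a - b) / 2) : a = b := by
  by_contra hab
  obtain ⟨t1, t2, t3⟩ := h.twin h1 hn hne
  have := twin_lt_pi_div_two (by linarith [h.a_pos, h.b_pos]) t1 t2 t3
  linarith [(h.twin_ab hab).1]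

lemma twin_of_symm (h : Extension n X a a) {j : ℕ} (h1 : 1 ≤ j) (hn : j < n) (hne : X j ≠ π) :
    0 < |X j - π| ∧ a + |X j - π| < π ∧ f (π - a - |X j - π|) = f (π - a + |X j - π|) := by
  simpa using h.twin h1 hn (by simpa using hne)

lemma strictMono (h : Extension n X a b) : StrictMono X := strictMono_nat_of_lt_succ h.lt_succ

/-- By `twin_unique`, two old satellites off the axis of symmetry are mirror images. -/
lemma add_eq_two_pi (h : Extension n X a a) {i j : ℕ} (h1 : 1 ≤ i) (hij : i < j) (hn : j < n)
    (hi : X i ≠ π) (hj : X j ≠ π) : X i + X j = 2 * π := by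
  obtain ⟨i1, i2, i3⟩ := h.twin_of_symm h1 (hij.trans hn) hi
  obtain ⟨j1, j2, j3⟩ := h.twin_of_symm (h1.trans hij.le) hn hj
  have := h.strictMono hij
  rcases abs_eq_abs.1 (twin_unique h.a_pos i1 j1 i2 j2 i3 j3) with he | he <;> linarith

lemma case_two (h : Extension 2 X a b) :
    X 1 = π ∧ a = b ∧ (a = π / 3 ∨ a = π / 2 ∨ a = 2 * π / 3) := by
  have ha := h.a_pos
  have hb := h.b_pos
  have hgt := h.gt 1 le_rfl one_lt_two
  have hlt := h.lt 1 le_rfl one_lt_two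
  have h0 : f (X 1) = 0 := by
    simpa [Finset.sum_range_succ, h.zero, f_zero] using h.central 0 two_pos
  have hpi := pi_pos
  have haxis (hab : a ≠ b) : X 1 = π - (a - b) / 2 := by
    by_contra hne
    exact hab (h.eq_of_ne le_rfl one_lt_two hne)
  -- If `X 1` is one of the zeros `π / 3` and `5 * π / 3`, then either `X 1` itself (for `a = b`) or
  -- the pair `a, b` (otherwise) gives a pair of twins whose half-difference is exactly `2 * π / 3`.
  have hX : X 1 = π := by
    rcases f_eq_zero (by linarith) (by linarith) h0 with hX | hX | hX
    · exfalso
      by_cases hab : a = b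
      · subst hab
        obtain ⟨t1, t2, t3⟩ := h.twin_of_symm le_rfl one_lt_two (by linarith)
        have := (abs_lt.1 (twin_lt_two_pi_div_three ha t1 t2 t3)).1
        linarith
      · have := (abs_lt.1 (h.twin_ab hab).2).2
        linarith [haxis hab]
    · exact hX
    · exfalso
      by_cases hab : a = b
      · subst hab
        obtain ⟨t1, t2, t3⟩ := h.twin_of_symm le_rfl one_lt_two (by linarith)
        have := (abs_lt.1 (twin_lt_two_pi_div_three ha t1 t2 t3)).2
        linarith
      · have := (abs_lt.1 (h.twin_ab hab).2).1
        linarith [haxis hab]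
  have hab : a = b := by
    by_contra hab
    exact hab (h.eq_of_ne le_rfl one_lt_two fun he => hab (by linarith))
  subst hab
  refine ⟨hX, rfl, add_double_eq ha (by linarith) ?_⟩
  have hP := h.new
  simp only [Finset.sum_range_succ, Finset.sum_range_zero, h.zero, hX, zero_add] at hP
  rw [show π + a = 2 * π - (π - a) by ring, f_two_pi_sub, ← two_mul] at hP
  linarith

lemma symm_of_three_le (h : Extension n X a b) (hn : 3 ≤ n) : a = b := by
  have h12 := h.strictMono one_lt_two
  by_cases h1 : X 1 = π - (a - b) / 2
  · exact h.eq_of_ne (j := 2) one_le_two (by linarith) (by linarith)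
  · exact h.eq_of_ne (j := 1) le_rfl (by linarith) h1

lemma not_three (h : Extension 3 X a b) : False := by
  obtain rfl := h.symm_of_three_le le_rfl
  have ha := h.a_pos
  have hpi := pi_pos
  have h12 := h.strictMono one_lt_two
  have h01 := h.strictMono one_pos
  have h2 := h.lt 2 one_le_two (by norm_num)
  have c0 := h.central 0 (by norm_num)
  have c1 := h.central 1 (by norm_num)
  have hP := h.new
  rw [h.zero] at h01
  simp only [Finset.sum_range_succ, Finset.sum_range_zero, h.zero, zero_add, sub_zero, sub_self,
    f_zero, zero_sub, f_neg, add_zero] at c0 c1 hP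
  -- If one of the satellites is at `π`, the other one is at `π / 3` or `5 * π / 3`, but its distance
  -- `2 * π / 3` from the first one would have to be a zero of `f` as well.
  by_cases hX1 : X 1 = π
  · rw [hX1, f_pi, zero_add] at c0
    rw [hX1, f_pi] at c1
    rcases f_eq_zero (by linarith) (by linarith) c0 with hX | hX | hX
    · linarith
    · linarith
    · rcases f_eq_zero (x := X 2 - π) (by linarith) (by linarith) (by linarith) with
        h0 | h0 | h0 <;> linarith
  by_cases hX2 : X 2 = π
  · rw [hX2, f_pi, add_zero] at c0
    rw [hX2, c0] at c1
    rcases f_eq_zero (by linarith) (by linarith) c0 with hX | hX | hX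
    · rcases f_eq_zero (x := π - X 1) (by linarith) (by linarith) (by linarith) with
        h0 | h0 | h0 <;> linarith
    · linarith
    · linarith
  have hs := h.add_eq_two_pi le_rfl one_lt_two (by norm_num) hX1 hX2
  obtain ⟨t1, t2, t3⟩ := h.twin_of_symm one_le_two (by norm_num) hX2
  obtain ⟨δ, hδ⟩ : ∃ δ, X 2 - π = δ := ⟨_, rfl⟩
  have hX1' : X 1 = π - δ := by linarith
  have hX2' : X 2 = π + δ := by linarith
  rw [hδ, abs_of_pos (by linarith)] at t1 t2 t3
  rw [hX1', hX2', show π + δ - (π - δ) = 2 * δ by ring] at c1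
  rw [hX1', hX2', show π - δ + a = 2 * π - (π - a + δ) by ring, f_two_pi_sub,
    show π + δ + a = 2 * π - (π - a - δ) by ring, f_two_pi_sub, ← two_mul] at hP
  exact no_extension_three ha t1 t2 t3 (by linarith) (by linarith)

lemma case_four (h : Extension 4 X a b) :
    a = π / 3 ∧ b = π / 3 ∧ X 1 = 2 * π / 3 ∧ X 2 = π ∧ X 3 = 4 * π / 3 := by
  obtain rfl := h.symm_of_three_le (by norm_num)
  have ha := h.a_pos
  have h12 := h.strictMono one_lt_two
  have h23 := h.strictMono (show 2 < 3 by norm_num)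
  have c1 := h.central 1 (by norm_num)
  have hP := h.new
  have hX2 : X 2 = π := by
    by_contra h2
    have k12 := h.add_eq_two_pi le_rfl one_lt_two (by norm_num) (hj := h2)
    have k23 := h.add_eq_two_pi one_le_two (show 2 < 3 by norm_num) (by norm_num) h2
    by_cases h1 : X 1 = π
    · linarith [k23 (by linarith)]
    · by_cases h3 : X 3 = π
      · linarith [k12 h1]
      · linarith [k12 h1, k23 h3]
  have hs := h.add_eq_two_pi (i := 1) (j := 3) le_rfl (by norm_num) (by norm_num) (by linarith)
    (by linarith)
  obtain ⟨t1, t2, t3⟩ := h.twin_of_symm (j := 3) (by norm_num) (by norm_num) (by linarith)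
  obtain ⟨δ, hδ⟩ : ∃ δ, X 3 - π = δ := ⟨_, rfl⟩
  have hX1 : X 1 = π - δ := by linarith
  have hX3 : X 3 = π + δ := by linarith
  rw [hδ, abs_of_pos (by linarith)] at t1 t2 t3
  simp only [Finset.sum_range_succ, Finset.sum_range_zero, h.zero, zero_add, sub_self,
    f_zero, zero_sub, f_neg, add_zero, hX1, hX2, hX3] at c1 hP
  rw [show π + δ - (π - δ) = 2 * δ by ring, show π - (π - δ) = δ by ring] at c1
  rw [show π - δ + a = 2 * π - (π - a + δ) by ring, f_two_pi_sub,
    show π + δ + a = 2 * π - (π - a - δ) by ring, f_two_pi_sub,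
    show π + a = 2 * π - (π - a) by ring, f_two_pi_sub, ← two_mul] at hP
  obtain ⟨e1, e2⟩ := extension_four ha t1 t2 t3 (by linarith) (by linarith)
  exact ⟨e1, e1, by linarith, hX2, by linarith⟩

lemma le_four (h : Extension n X a b) : n ≤ 4 := by
  by_contra! hn
  obtain rfl := h.symm_of_three_le (by linarith)
  have h12 := h.strictMono one_lt_two
  have h23 := h.strictMono (show 2 < 3 by norm_num)
  have h34 := h.strictMono (show 3 < 4 by norm_num)
  have key {i j : ℕ} := h.add_eq_two_pi (i := i) (j := j)
  have k12 := key le_rfl one_lt_two (by linarith)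
  have k13 := key (i := 1) (j := 3) le_rfl (by norm_num) (by linarith)
  have k34 := key (i := 3) (j := 4) (by norm_num) (by norm_num) (by linarith)
  have k24 := key (i := 2) (j := 4) (by norm_num) (by norm_num) (by linarith)
  by_cases h1 : X 1 = π
  · linarith [k24 (by linarith) (by linarith)]
  by_cases h2 : X 2 = π
  · linarith [k34 (by linarith) (by linarith)]
  by_cases h3 : X 3 = π
  · linarith [k12 h1 h2]
  linarith [k12 h1 h2, k13 h1 h3]

end Extension

/-! ### Positions of the satellites -/

lemma ofNat_add {n : ℕ} [NeZero n] (a b : ℕ) :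
    Fin.ofNat n a + Fin.ofNat n b = Fin.ofNat n (a + b) := by
  ext; simp [Fin.val_add, Nat.add_mod]

lemma arc_zero {n : ℕ} [NeZero n] (θ : Fin n → ℝ) (i : Fin n) : arc θ i 0 = 0 := by simp [arc]

lemma arc_succ {n : ℕ} [NeZero n] (θ : Fin n → ℝ) (i : Fin n) (k : ℕ) :
    arc θ i (k + 1) = arc θ i k + θ (i + Fin.ofNat n k) := by
  simp only [arc, Finset.sum_range_succ]

lemma arc_one {n : ℕ} [NeZero n] (θ : Fin n → ℝ) (i : Fin n) : arc θ i 1 = θ i := by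
  rw [arc_succ, arc_zero, zero_add]; congr 1; ext; simp

lemma arc_add {n : ℕ} [NeZero n] (θ : Fin n → ℝ) (i : Fin n) (m k : ℕ) :
    arc θ i (m + k) = arc θ i m + arc θ (i + Fin.ofNat n m) k := by
  simp only [arc, Finset.sum_range_add, add_assoc, ofNat_add]

lemma arc_self {n : ℕ} [NeZero n] {θ : Fin n → ℝ} (h : IsConfiguration θ) (i : Fin n) :
    arc θ i n = 2 * π := by
  rw [← h.2, arc, Finset.sum_range, ← Equiv.sum_comp (Equiv.addLeft i) θ]
  simp

lemma arc_lt_succ {n : ℕ} [NeZero n] {θ : Fin n → ℝ} (h : IsConfiguration θ) (i : Fin n) (k : ℕ) :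
    arc θ i k < arc θ i (k + 1) := by
  rw [arc_succ]; linarith [h.1 (i + Fin.ofNat n k)]

lemma sum_range_add_of_periodic {n : ℕ} {g : ℕ → ℝ} (hg : ∀ k, g (k + n) = g k) (m : ℕ) :
    ∑ k ∈ Finset.range n, g (m + k) = ∑ k ∈ Finset.range n, g k := by
  induction m with
  | zero => simp
  | succ m ih =>
    have h1 := Finset.sum_range_succ (fun k => g (m + k)) n
    have h2 := Finset.sum_range_succ' (fun k => g (m + k)) n
    rw [h1, hg, add_zero] at h2
    rw [← ih, add_right_cancel h2]
    exact Finset.sum_congr rfl fun k _ => by congr 1; ring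

/-- The equations of a central configuration in terms of the positions of the satellites. Since
`f 0 = 0`, the sum may run over all satellites. -/
lemma IsCentralConfiguration.sum_eq_zero {n : ℕ} [NeZero n] {μ : ℝ} (hμ : 0 < μ) {θ : Fin n → ℝ}
    (h : IsCentralConfiguration (fun _ => μ) θ) (i : Fin n) (m : ℕ) :
    ∑ j ∈ Finset.range n, f (arc θ i j - arc θ i m) = 0 := by
  have h1 := h.2 (i + Fin.ofNat n m)
  rw [← Finset.mul_sum] at h1
  have h2 := (mul_eq_zero.1 h1).resolve_left hμ.ne'
  rw [← sum_range_add_of_periodic (m := m)]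
  · rw [Finset.range_eq_Ico, Finset.sum_eq_sum_Ico_succ_bot (NeZero.pos n), add_zero, sub_self,
      f_zero, zero_add, ← h2]
    exact Finset.sum_congr rfl fun k _ => by rw [arc_add, add_sub_cancel_left]
  · intro k
    rw [add_comm k, arc_add, arc_self h.1, ← f_add_two_pi (arc θ i k - arc θ i m)]
    have : i + Fin.ofNat n n = i := by ext; simp
    rw [this]; congr 1; ring

/-- A sum over all satellites after the addition consists of the sum over the old ones and the terms
of the two new ones, which have the numbers `1` and `n + 1`. -/
lemma sum_range_add_two {n : ℕ} (hn : 1 ≤ n) {X Y : ℕ → ℝ} (h0 : Y 0 = X 0)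
    (hXY : ∀ j, 1 ≤ j → j < n → Y (j + 1) = X j) (g : ℝ → ℝ) :
    ∑ j ∈ Finset.range (n + 2), g (Y j) =
      ∑ j ∈ Finset.range n, g (X j) + g (Y 1) + g (Y (n + 1)) := by
  obtain ⟨n, rfl⟩ : ∃ k, n = k + 1 := ⟨n - 1, by omega⟩
  rw [Finset.sum_range_succ, Finset.sum_range_succ', Finset.sum_range_succ',
    Finset.sum_range_succ' _ n, h0]
  have : ∑ j ∈ Finset.range n, g (Y (j + 1 + 1)) = ∑ j ∈ Finset.range n, g (X (j + 1)) :=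
    Finset.sum_congr rfl fun j hj => by
      rw [hXY (j + 1) (by omega) (by have := Finset.mem_range.1 hj; omega)]
  rw [this]; simp only [zero_add]; ring

section Position
variable {n : ℕ} [NeZero n] {θ : Fin n → ℝ} {θ' : Fin (n + 2) → ℝ} {k : Fin n} {l : Fin (n + 2)}

/-- Measured from the old satellite between the two new ones, an old satellite has the same position
before and after the addition, while its number grows by one. -/
lemma arc_new_succ (h1 : θ (k + 1) = θ' (l + 2) + θ' (l + 3))
    (h2 : ∀ i : ℕ, 2 ≤ i → i < n → θ (k + Fin.ofNat n i) = θ' (l + Fin.ofNat (n + 2) (i + 2)))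
    (j : ℕ) (hj : 1 ≤ j) (hn : j < n) : arc θ' (l + 2) (j + 1) = arc θ (k + 1) j := by
  induction j, hj using Nat.le_induction with
  | base =>
    rw [arc_succ, arc_succ, arc_succ, arc_zero, arc_zero]
    have e0 : k + 1 + Fin.ofNat n 0 = k + 1 := by ext; simp
    have e1 : l + 2 + Fin.ofNat (n + 2) 0 = l + 2 := by ext; simp
    have e2 : l + 2 + Fin.ofNat (n + 2) 1 = l + 3 := by
      rw [add_assoc]; congr 1
      exact ofNat_add 2 1
    rw [e0, e1, e2, h1]; ring
  | succ j hj ih =>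
    rw [arc_succ, ih (by omega), arc_succ θ]
    have e0 : k + 1 + Fin.ofNat n j = k + Fin.ofNat n (j + 1) := by
      rw [add_assoc, add_comm j]; congr 1
      rw [← ofNat_add]; congr 1
    have e1 : l + 2 + Fin.ofNat (n + 2) (j + 1) = l + Fin.ofNat (n + 2) (j + 1 + 2) := by
      rw [add_assoc, add_comm (j + 1)]; congr 1
      exact ofNat_add 2 (j + 1)
    rw [e0, e1, h2 _ (by omega) hn]

omit [NeZero n] in
lemma arc_new_last (h : IsConfiguration θ') :
    arc θ' (l + 2) (n + 1) = 2 * π - θ' (l + 1) := by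
  have h1 := arc_self h (l + 2)
  rw [arc_succ] at h1
  have e : l + 2 + Fin.ofNat (n + 2) (n + 1) = l + 1 := by
    rw [add_assoc]; congr 1
    change Fin.ofNat (n + 2) 2 + _ = Fin.ofNat (n + 2) 1
    rw [ofNat_add, show 2 + (n + 1) = 1 + (n + 2) by ring]
    ext; simp
  rw [e] at h1
  linarith

/-- The equations of an old satellite before and after the addition differ by `balance`. -/
lemma extension_of_central (hn : 2 ≤ n) {μ : ℝ} (hμ : 0 < μ)
    (hθ : IsCentralConfiguration (fun _ => μ) θ) (hθ' : IsCentralConfiguration (fun _ => μ) θ')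
    (h1 : θ (k + 1) = θ' (l + 2) + θ' (l + 3))
    (h2 : ∀ i : ℕ, 2 ≤ i → i < n → θ (k + Fin.ofNat n i) = θ' (l + Fin.ofNat (n + 2) (i + 2))) :
    Extension n (arc θ (k + 1)) (θ' (l + 1)) (θ' (l + 2)) := by
  have hXY := arc_new_succ h1 h2
  have hmono : StrictMono (arc θ' (l + 2)) := strictMono_nat_of_lt_succ (arc_lt_succ hθ'.1 _)
  have hlast := arc_new_last (l := l) hθ'.1
  have hone := arc_one θ' (l + 2)
  have hsum (y : ℝ) := sum_range_add_two (n := n) (by omega)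
    (by rw [arc_zero, arc_zero] : arc θ' (l + 2) 0 = arc θ (k + 1) 0) hXY (fun x => f (x - y))
  have hS (m : ℕ) : ∑ j ∈ Finset.range n, f (arc θ (k + 1) j - arc θ' (l + 2) m) +
      f (θ' (l + 2) - arc θ' (l + 2) m) +
      f (2 * π - θ' (l + 1) - arc θ' (l + 2) m) = 0 := by
    rw [← hθ'.sum_eq_zero hμ (l + 2) m, hsum, hone, hlast]
  refine ⟨hn, hθ'.1.1 _, hθ'.1.1 _, arc_zero _ _, arc_lt_succ hθ.1 _, fun j h1 h2 => ?_,
    fun j h1 h2 => ?_, fun m _ => hθ.sum_eq_zero hμ _ m, fun j hj => ?_, ?_⟩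
  · rw [← hXY j h1 h2, ← hone]; exact hmono (by omega)
  · rw [← hXY j h1 h2, ← hlast]; exact hmono (by omega)
  · obtain ⟨m, hm⟩ : ∃ m, arc θ' (l + 2) m = arc θ (k + 1) j := by
      rcases Nat.eq_zero_or_pos j with rfl | h0
      · exact ⟨0, by rw [arc_zero, arc_zero]⟩
      · exact ⟨j + 1, hXY j h0 hj⟩
    have := hS m
    rw [hm, hθ.sum_eq_zero hμ, sub_sub, f_two_pi_sub] at this
    linarith
  · have := hS (n + 1)
    rw [hlast, sub_self, f_zero, add_zero] at this
    have hf (x : ℝ) : f (x - (2 * π - θ' (l + 1))) = f (x + θ' (l + 1)) := by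
      rw [← f_add_two_pi]; congr 1; ring
    simp only [hf] at this
    rw [add_comm (θ' (l + 1))]
    exact this
end Position

/-! ### Cyclic relabelling -/

lemma rotate_ofFn {n : ℕ} [NeZero n] (θ : Fin n → ℝ) (m : ℕ) :
    (List.ofFn θ).rotate m = List.ofFn fun j => θ (Fin.ofNat n m + j) := by
  apply List.ext_getElem (by simp)
  intro i h1 h2
  rw [List.getElem_rotate, List.getElem_ofFn, List.getElem_ofFn]
  congr 1
  ext
  simp [Fin.val_add, add_comm]

lemma sameUpToRotation_iff {n : ℕ} [NeZero n] {θ K : Fin n → ℝ} :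
    SameUpToRotation θ (List.ofFn K) ↔ ∃ i, ∀ j, θ (i + j) = K j := by
  constructor
  · rintro ⟨m, hm⟩
    rw [rotate_ofFn] at hm
    exact ⟨_, congrFun (List.ofFn_injective hm)⟩
  · rintro ⟨i, hi⟩
    refine ⟨i, ?_⟩
    rw [rotate_ofFn, Fin.ofNat_val_eq_self]
    exact congrArg List.ofFn (funext hi)

lemma arc_rotate {n : ℕ} [NeZero n] {θ K : Fin n → ℝ} {i : Fin n} (h : ∀ j, θ (i + j) = K j)
    (j : Fin n) (m : ℕ) : arc θ (i + j) m = arc K j m := by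
  simp only [arc, add_assoc, h]

lemma IsConfiguration.rotate {n : ℕ} [NeZero n] {θ K : Fin n → ℝ} {i : Fin n}
    (h : ∀ j, θ (i + j) = K j) (hK : IsConfiguration K) : IsConfiguration θ := by
  constructor
  · intro j
    have := hK.1 (j - i)
    rw [← h, add_sub_cancel] at this
    exact this
  · rw [← hK.2, ← Equiv.sum_comp (Equiv.addLeft i) θ]
    exact Finset.sum_congr rfl fun j _ => h j

lemma IsCentralConfiguration.rotate {n : ℕ} [NeZero n] {μ : ℝ} {θ K : Fin n → ℝ} {i : Fin n}
    (h : ∀ j, θ (i + j) = K j) (hK : IsCentralConfiguration (fun _ => μ) K) :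
    IsCentralConfiguration (fun _ => μ) θ := by
  refine ⟨hK.1.rotate h, fun j => ?_⟩
  rw [← hK.2 (j - i)]
  refine Finset.sum_congr rfl fun m _ => ?_
  rw [← arc_rotate h, add_sub_cancel]

lemma collinear_eq : collinear = List.ofFn fun _ : Fin 2 => π := by simp [collinear]
lemma square_eq : square = List.ofFn fun _ : Fin 4 => π / 2 := by simp [square]
lemma hexagon_eq : hexagon = List.ofFn fun _ : Fin 6 => π / 3 := by simp [hexagon]
lemma kite_eq : kite = List.ofFn ![π / 3, π / 3, 2 * π / 3, 2 * π / 3] := by simp [kite]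

/-! ### The configurations that occur -/

/-- Regular polygons are central configurations: the forces of mirror images cancel. -/
lemma isCentralConfiguration_const {n : ℕ} [NeZero n] (μ c : ℝ) (hc : 0 < c)
    (hn : n * c = 2 * π) : IsCentralConfiguration (fun _ => μ) (fun _ : Fin n => c) := by
  refine ⟨⟨fun _ => hc, by simp [hn]⟩, fun i => ?_⟩
  have harc (k : ℕ) : arc (fun _ : Fin n => c) i k = k * c := by simp [arc]
  simp only [harc, ← Finset.mul_sum]
  have h1 := Finset.sum_Ico_reflect (fun k : ℕ => f (k * c)) 1 (Nat.le_succ n)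
  have h2 : ∑ k ∈ Finset.Ico 1 n, f ((n - k : ℕ) * c) = -∑ k ∈ Finset.Ico 1 n, f (k * c) := by
    rw [← Finset.sum_neg_distrib]
    refine Finset.sum_congr rfl fun k hk => ?_
    rw [Nat.cast_sub (Finset.mem_Ico.1 hk).2.le, sub_mul, hn, f_two_pi_sub]
  rw [h2, Nat.add_sub_cancel_left, Nat.add_sub_cancel] at h1
  rw [show ∑ k ∈ Finset.Ico 1 n, f (k * c) = 0 by linarith, mul_zero]

lemma isCentralConfiguration_kite (μ : ℝ) :
    IsCentralConfiguration (fun _ => μ) ![π / 3, π / 3, 2 * π / 3, 2 * π / 3] := by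
  have hpi := pi_pos
  refine ⟨⟨fun i => ?_, ?_⟩, fun i => ?_⟩
  · fin_cases i <;> simp <;> positivity
  · simp [Fin.sum_univ_four]; ring
  have h1 : f (5 * π / 3) = 0 := by
    rw [show 5 * π / 3 = 2 * π - π / 3 by ring, f_two_pi_sub, f_pi_div_three, neg_zero]
  have h2 : f (4 * π / 3) = -f (2 * π / 3) := by
    rw [show 4 * π / 3 = 2 * π - 2 * π / 3 by ring, f_two_pi_sub]
  have h3 := f_pi_div_three
  have h4 := f_pi
  have e1 : π / 3 + π / 3 = 2 * π / 3 := by ring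
  have e2 : 2 * π / 3 + 2 * π / 3 = 4 * π / 3 := by ring
  have e3 : π / 3 + 2 * π / 3 = π := by ring
  have e4 : 2 * π / 3 + π / 3 = π := by ring
  have e5 : π + 2 * π / 3 = 5 * π / 3 := by ring
  have e6 : π + π / 3 = 4 * π / 3 := by ring
  have e7 : 4 * π / 3 + π / 3 = 5 * π / 3 := by ring
  rw [← Finset.mul_sum]
  fin_cases i <;>
    simp [Finset.sum_Ico_succ_top, arc, Finset.sum_range_succ, Fin.ofNat, e1, e2, e3, e4, e5, e6,
      e7, h1, h2, h3, h4]

/-- The angles of a tuple that starts at `i + s`, from positions measured from `i + c`. -/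
lemma eq_arc_sub_arc {n : ℕ} [NeZero n] (θ : Fin n → ℝ) (i c s j : Fin n) (m : ℕ)
    (h : s + j = c + Fin.ofNat n m) :
    θ (i + s + j) = arc θ (i + c) (m + 1) - arc θ (i + c) m := by
  rw [arc_succ, add_sub_cancel_left, add_assoc, h, add_assoc]

end Coorbital

end

theorem proposition2 (n : ℕ) [NeZero n] (hn : 2 ≤ n) (μ : ℝ) (hμ : 0 < μ)
    (θ : Fin n → ℝ) (θ' : Fin (n + 2) → ℝ) :
    (Coorbital.IsCentralConfiguration (fun _ => μ) θ ∧
      Coorbital.AddTwoSeparatedByOne θ θ' ∧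
      Coorbital.IsCentralConfiguration (fun _ => μ) θ') ↔
    ((n = 2 ∧ Coorbital.SameUpToRotation θ Coorbital.collinear ∧
        (Coorbital.SameUpToRotation θ' Coorbital.square ∨
          Coorbital.SameUpToRotation θ' Coorbital.kite)) ∨
      (n = 4 ∧ Coorbital.SameUpToRotation θ Coorbital.kite ∧
        Coorbital.SameUpToRotation θ' Coorbital.hexagon)) := by
  open Coorbital in
  constructor
  · rintro ⟨hθ, ⟨-, -, k, l, -, h1, h2⟩, hθ'⟩
    have hE := extension_of_central hn hμ hθ hθ' h1 h2
    have hXY := arc_new_succ h1 h2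
    have hlast := arc_new_last (l := l) hθ'.1
    have hXn := arc_self hθ.1 (k + 1)
    have hYn := arc_self hθ'.1 (l + 2)
    have hn4 := hE.le_four
    obtain rfl | rfl | rfl : n = 2 ∨ n = 3 ∨ n = 4 := by omega
    · left
      obtain ⟨x1, hab, ha⟩ := hE.case_two
      rw [collinear_eq, square_eq, kite_eq, sameUpToRotation_iff, sameUpToRotation_iff,
        sameUpToRotation_iff]
      have y1 := arc_one θ' (l + 2)
      have y2 := hXY 1 le_rfl one_lt_two
      rw [x1] at y2
      rw [← hab] at y1
      refine ⟨rfl, ⟨k + 1, fun j => ?_⟩, ?_⟩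
      · fin_cases j
        · refine (eq_arc_sub_arc θ k 1 1 _ 0 rfl).trans ?_
          rw [x1, arc_zero, sub_zero]
        · refine (eq_arc_sub_arc θ k 1 1 _ 1 rfl).trans ?_
          rw [hXn, x1]; ring
      · rcases ha with ha | ha | ha <;> rw [ha] at y1 hlast
        -- `a = π / 3` gives the kite read from the new satellite at `-a`, `a = 2 * π / 3` the kite
        -- read from the one at `b`.
        · refine Or.inr ⟨l + 1, fun j => ?_⟩
          fin_cases j
          · rw [eq_arc_sub_arc θ' l 2 1 _ 3 rfl, hYn, hlast]; simp
          · rw [eq_arc_sub_arc θ' l 2 1 _ 0 rfl, y1, arc_zero]; simp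
          · rw [eq_arc_sub_arc θ' l 2 1 _ 1 rfl, y2, y1]; simp; ring
          · rw [eq_arc_sub_arc θ' l 2 1 _ 2 rfl, hlast, y2]; simp; ring
        · refine Or.inl ⟨l + 2, fun j => ?_⟩
          fin_cases j
          · refine (eq_arc_sub_arc θ' l 2 2 _ 0 rfl).trans ?_
            rw [y1, arc_zero]; ring
          · refine (eq_arc_sub_arc θ' l 2 2 _ 1 rfl).trans ?_
            rw [y2, y1]; ring
          · refine (eq_arc_sub_arc θ' l 2 2 _ 2 rfl).trans ?_
            rw [hlast, y2]; ring
          · refine (eq_arc_sub_arc θ' l 2 2 _ 3 rfl).trans ?_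
            rw [hYn, hlast]; ring
        · refine Or.inr ⟨l + 3, fun j => ?_⟩
          fin_cases j
          · rw [eq_arc_sub_arc θ' l 2 3 _ 1 rfl, y2, y1]; simp; ring
          · rw [eq_arc_sub_arc θ' l 2 3 _ 2 rfl, hlast, y2]; simp; ring
          · rw [eq_arc_sub_arc θ' l 2 3 _ 3 rfl, hYn, hlast]; simp
          · rw [eq_arc_sub_arc θ' l 2 3 _ 0 rfl, y1, arc_zero]; simp
    · exact hE.not_three.elim
    · right
      obtain ⟨ha, hb, x1, x2, x3⟩ := hE.case_four
      rw [kite_eq, hexagon_eq, sameUpToRotation_iff, sameUpToRotation_iff]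
      refine ⟨rfl, ⟨k + 2, fun j => ?_⟩, l + 2, fun j => ?_⟩
      · fin_cases j
        · rw [eq_arc_sub_arc θ k 1 2 _ 1 rfl, x2, x1]; simp; ring
        · rw [eq_arc_sub_arc θ k 1 2 _ 2 rfl, x3, x2]; simp; ring
        · rw [eq_arc_sub_arc θ k 1 2 _ 3 rfl, hXn, x3]; simp; ring
        · rw [eq_arc_sub_arc θ k 1 2 _ 0 rfl, x1, arc_zero]; simp
      · have y1 := arc_one θ' (l + 2)
        have y2 := hXY 1 (by norm_num) (by norm_num)
        have y3 := hXY 2 (by norm_num) (by norm_num)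
        have y4 := hXY 3 (by norm_num) (by norm_num)
        rw [hb] at y1
        rw [x1] at y2
        rw [x2] at y3
        rw [x3] at y4
        rw [ha] at hlast
        fin_cases j
        · refine (eq_arc_sub_arc θ' l 2 2 _ 0 rfl).trans ?_
          rw [y1, arc_zero]; ring
        · refine (eq_arc_sub_arc θ' l 2 2 _ 1 rfl).trans ?_
          rw [y2, y1]; ring
        · refine (eq_arc_sub_arc θ' l 2 2 _ 2 rfl).trans ?_
          rw [y3, y2]; ring
        · refine (eq_arc_sub_arc θ' l 2 2 _ 3 rfl).trans ?_
          rw [y4, y3]; ring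
        · refine (eq_arc_sub_arc θ' l 2 2 _ 4 rfl).trans ?_
          rw [hlast, y4]; ring
        · refine (eq_arc_sub_arc θ' l 2 2 _ 5 rfl).trans ?_
          rw [hYn, hlast]; ring
  · rintro (⟨rfl, h1, h2⟩ | ⟨rfl, h1, h2⟩)
    · rw [collinear_eq, sameUpToRotation_iff] at h1
      obtain ⟨k, hk⟩ := h1
      have hθ := (isCentralConfiguration_const μ π pi_pos (by norm_num)).rotate hk
      have hk' (i : Fin 2) : θ i = π := by rw [← hk (i - k), add_sub_cancel]
      rcases h2 with h2 | h2
      · rw [square_eq, sameUpToRotation_iff] at h2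
        obtain ⟨l, hl⟩ := h2
        have hθ' := (isCentralConfiguration_const μ (π / 2) (by positivity)
          (by norm_num; ring)).rotate hl
        have hl' (i : Fin 4) : θ' i = π / 2 := by rw [← hl (i - l), add_sub_cancel]
        refine ⟨hθ, ⟨hθ.1, hθ'.1, k, l, ?_, ?_, fun i hi hi' => by omega⟩, hθ'⟩
        · rw [hk' k, hl' l, hl' (l + 1)]; ring
        · rw [hk' (k + 1), hl' (l + 2), hl' (l + 3)]; ring
      · rw [kite_eq, sameUpToRotation_iff] at h2
        obtain ⟨l, hl⟩ := h2
        have hθ' := (isCentralConfiguration_kite μ).rotate hl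
        refine ⟨hθ, ⟨hθ.1, hθ'.1, k, l + 1, ?_, ?_, fun i hi hi' => by omega⟩, hθ'⟩
        · have e1 : θ' (l + 1) = π / 3 := hl 1
          have e2 : θ' (l + 1 + 1) = 2 * π / 3 := by rw [add_assoc]; exact hl 2
          rw [hk' k, e1, e2]; ring
        · have e1 : θ' (l + 1 + 2) = 2 * π / 3 := by rw [add_assoc]; exact hl 3
          have e2 : θ' (l + 1 + 3) = π / 3 := by rw [add_assoc]; exact hl 0
          rw [hk' (k + 1), e1, e2]; ring
    · rw [kite_eq, sameUpToRotation_iff] at h1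
      rw [hexagon_eq, sameUpToRotation_iff] at h2
      obtain ⟨k, hk⟩ := h1
      obtain ⟨l, hl⟩ := h2
      have hθ := (isCentralConfiguration_kite μ).rotate hk
      have hθ' := (isCentralConfiguration_const μ (π / 3) (by positivity)
          (by norm_num; ring)).rotate hl
      have hl' (i : Fin 6) : θ' i = π / 3 := by rw [← hl (i - l), add_sub_cancel]
      refine ⟨hθ, ⟨hθ.1, hθ'.1, k + 2, l, ?_, ?_, fun i hi hi' => ?_⟩, hθ'⟩
      · have e1 : θ (k + 2) = 2 * π / 3 := hk 2
        rw [hl' l, hl' (l + 1), e1]; ring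
      · have e1 : θ (k + 2 + 1) = 2 * π / 3 := by rw [add_assoc]; exact hk 3
        rw [hl' (l + 2), hl' (l + 3), e1]; ring
      · rw [hl' (l + _), add_assoc]
        interval_cases i
        · exact hk 0
        · exact hk 1
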